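/- Notation. For $m,n\ge 0$ identify $M_m\otimes M_n$ with the matrices acting on $\mathbb{C}^m\otimes\mathbb{C}^n$. A density matrix is a positive semidefinite matrix of trace $1$. Let $S$ be the convex set of separable states on $M_m\otimes M_n$, i.e. the density matrices of the form $\sum_i X_i\otimes Y_i$ (a finite sum) with $X_i\in M_m$ and $Y_i\in M_n$ positive semidefinite. A face of $S$ is a subset $F\subseteq S$ such that whenever $X,Y\in S$, $0<t<1$ and $tX+(1-t)Y\in F$, then $X,Y\in F$. For $X\in S$, $\mathrm{face}_S(X)$ is the smallest face of $S$ containing $X$; if $X\neq 0$ is a positive multiple of an element of $S$, $\mathrm{face}_S(X)$ means $\mathrm{face}_S(X/\operatorname{tr}X)$, and $\mathrm{face}_S(0)=\emptyset$. For subspaces $V\subseteq\mathbb{C}^m$, $W\subseteq\mathbb{C}^n$, $\mathrm{Sep}(V\otimes W)$ is the set of $E\in S$ with $\operatorname{im}E\subseteq V\otimes W$. A set $D$ is the direct convex sum of convex sets $C_1,\dots,C_p$ if $D$ is the convex hull of $\bigcup_\gamma C_\gamma$ and each $x\in D$ has a unique convex decomposition $x=\sum_\gamma\lambda_\gamma x_\gamma$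 with $\lambda_\gamma\ge 0$, $\sum_\gamma\lambda_\gamma=1$ and $x_\gamma\in C_\gamma$; here terms with $\lambda_\gamma=0$ are disregarded (no $x_\gamma$ is required for them), so uniqueness means that all $\lambda_\gamma$, and the $x_\gamma$ with $\lambda_\gamma\ne 0$, are determined by $x$. Theorem. Let $T=\sum_{\gamma=1}^p A_\gamma\otimes B_\gamma$ be a density matrix in $M_m\otimes M_n$, where $A_1,\dots,A_p\in M_m$ are density matrices with pairwise disjoint ranges ($\operatorname{im}A_\gamma\cap\operatorname{im}A_\delta=\{0\}$ for $\gamma\neq\delta$) and $B_1,\dots,B_p\in M_n$ are positive semidefinite matrices whose images are independent (their sum is direct). Then $\mathrm{face}_S(T)$ is the direct convex sum of the convex sets $\mathrm{face}_S(A_\gamma\otimes B_\gamma)$, $1\le\gamma\le p$, and for each $\gamma$ $$\mathrm{face}_S(A_\gamma\otimes B_\gamma)=\mathrm{Sep}(\operatorname{im}A_\gamma\otimes\operatorname{im}B_\gamma).$$ -/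

import Mathlib

open scoped Kronecker ComplexOrder

namespace SepFaces

/-- The matrix algebra `M_m ⊗ M_n`, realised through the Kronecker product. -/
abbrev BiMat (m n : ℕ) : Type := Matrix (Fin m × Fin n) (Fin m × Fin n) ℂ

/-- A density matrix: positive semidefinite with trace one. -/
def IsDensity {ι : Type*} [Fintype ι] (A : Matrix ι ι ℂ) : Prop :=
  A.PosSemidef ∧ A.trace = 1

/-- The image (range) of a square matrix acting on column vectors. -/
def im {ι : Type*} [Fintype ι] (A : Matrix ι ι ℂ) : Submodule ℂ (ι → ℂ) :=
  LinearMap.range A.mulVecLin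

/-- The product vector `x ⊗ y` in `ℂ^m ⊗ ℂ^n`. -/
def prodVec {m n : ℕ} (x : Fin m → ℂ) (y : Fin n → ℂ) : Fin m × Fin n → ℂ :=
  fun ij => x ij.1 * y ij.2

/-- The subspace `V ⊗ W` of `ℂ^m ⊗ ℂ^n`: the span of all `x ⊗ y` with `x ∈ V`, `y ∈ W`. -/
def tensorSubspace {m n : ℕ} (V : Submodule ℂ (Fin m → ℂ)) (W : Submodule ℂ (Fin n → ℂ)) :
    Submodule ℂ (Fin m × Fin n → ℂ) :=
  Submodule.span ℂ {z | ∃ x ∈ V, ∃ y ∈ W, z = prodVec x y}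

/-- The separable states on `M_m ⊗ M_n`: density matrices that are finite sums of Kronecker
products of positive semidefinite matrices. -/
def separableStates (m n : ℕ) : Set (BiMat m n) :=
  {T | IsDensity T ∧
    ∃ (k : ℕ) (A : Fin k → Matrix (Fin m) (Fin m) ℂ) (B : Fin k → Matrix (Fin n) (Fin n) ℂ),
      (∀ i, (A i).PosSemidef) ∧ (∀ i, (B i).PosSemidef) ∧ T = ∑ i, A i ⊗ₖ B i}

/-- The separable states living on the subspace `V ⊗ W`. -/
def Sep {m n : ℕ} (V : Submodule ℂ (Fin m → ℂ)) (W : Submodule ℂ (Fin n → ℂ)) :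
    Set (BiMat m n) :=
  {E | E ∈ separableStates m n ∧ im E ≤ tensorSubspace V W}

/-- The smallest face of `C` containing the point `x` of `C`, i.e. the intersection of all faces
of `C` containing `x`; it is empty when `x` is not in `C`. -/
def generatedFace {E : Type*} [AddCommGroup E] [Module ℝ E] (C : Set E) (x : E) : Set E :=
  {y | x ∈ C ∧ ∀ F : Set E, IsExtreme ℝ C F → x ∈ F → y ∈ F}

theorem generatedFace_isLeast {E : Type*} [AddCommGroup E] [Module ℝ E] {C : Set E} {x : E}
    (hx : x ∈ C) : IsLeast {F : Set E | IsExtreme ℝ C F ∧ x ∈ F} (generatedFace C x) := by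
  refine ⟨⟨⟨fun y hy => hy.2 C (IsExtreme.refl ℝ C) hx, ?_⟩, hx, fun F _ h => h⟩,
    fun F hF y hy => hy.2 F hF.1 hF.2⟩
  intro a ha b hb z hz hzab
  exact ⟨hx, fun F hF hxF => hF.2 ha hb (hz.2 F hF hxF) hzab⟩

/-- The face of the separable state space generated by a positive semidefinite matrix `X`, not
necessarily of trace one: the face generated by the state `X / tr X`.
For `X = 0` this is empty. -/
def sepFace {m n : ℕ} (X : BiMat m n) : Set (BiMat m n) :=
  generatedFace (separableStates m n) (X.trace⁻¹ • X)

/-- `x = ∑ α, w α • y α` is a convex decomposition with `y α ∈ C α`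
(terms of weight zero are irrelevant). -/
def IsConvexDecomp {ι E : Type*} [Fintype ι] [AddCommGroup E] [Module ℝ E]
    (C : ι → Set E) (x : E) (w : ι → ℝ) (y : ι → E) : Prop :=
  (∀ α, 0 ≤ w α) ∧ ∑ α, w α = 1 ∧ (∀ α, w α ≠ 0 → y α ∈ C α) ∧ x = ∑ α, w α • y α

/-- `D` is the direct convex sum of the convex sets `C α`: it is the convex hull of their union,
and each of its points has a convex decomposition over the `C α` which is unique, i.e. the weights
are determined, and so are the components of nonzero weight. -/
def IsDirectConvexSum {ι E : Type*} [Fintype ι] [AddCommGroup E] [Module ℝ E]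
    (D : Set E) (C : ι → Set E) : Prop :=
  (∀ α, Convex ℝ (C α)) ∧ D = convexHull ℝ (⋃ α, C α) ∧
    ∀ x ∈ D, (∃ w y, IsConvexDecomp C x w y) ∧
      ∀ w y w' y', IsConvexDecomp C x w y → IsConvexDecomp C x w' y' →
        w = w' ∧ ∀ α, w α ≠ 0 → y α = y' α

end SepFaces

/-! Everything happens in the cone `sepCone` spanned by projectors onto product vectors. The face of
a state `X` consists of the states `Y` with `c • X - Y` in this cone for some `c`
(`generatedFace_separableStates`). Domination forces `im Y ≤ im X`; for `X = A ⊗ B` the converse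
also holds (`exists_smul_sub_mem_sepCone`), so the face is `Sep (im A) (im B)`.

For the sum, write `V γ`, `W γ` for the images of `A γ`, `B γ`. A product vector in the sum of the
`V γ ⊗ W γ` lies in a single one of them (`prodVec_mem_of_sum`). Hence each product projector in a
decomposition of `Y` belongs to one block, and grouping by blocks gives the convex decomposition.
Uniqueness holds because the `V γ ⊗ W γ` are independent as soon as the `W γ` are. -/

namespace SepFaces

open Matrix

/-! ### Images and order of positive semidefinite matrices. -/

section Linear

variable {ι : Type*} [Fintype ι]

theorem im_zero : im (0 : Matrix ι ι ℂ) = ⊥ := by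
  rw [im, Submodule.eq_bot_iff]
  rintro _ ⟨v, rfl⟩
  simp

theorem im_smul_le {c : ℂ} (A : Matrix ι ι ℂ) : im (c • A) ≤ im A := by
  rintro _ ⟨v, rfl⟩
  exact ⟨c • v, by simp⟩

theorem im_real_smul_le (c : ℝ) (A : Matrix ι ι ℂ) : im (c • A) ≤ im A := by
  have h : c • A = (c : ℂ) • A := by ext; simp
  rw [h]
  exact im_smul_le A

theorem im_add_le {A B : Matrix ι ι ℂ} {U : Submodule ℂ (ι → ℂ)}
    (hA : im A ≤ U) (hB : im B ≤ U) : im (A + B) ≤ U := by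
  rintro _ ⟨v, rfl⟩
  simp only [mulVecLin_apply, add_mulVec]
  exact U.add_mem (hA ⟨v, rfl⟩) (hB ⟨v, rfl⟩)

/-- For Hermitian matrices, an inclusion of kernels reverses to an inclusion of images. -/
theorem im_le_im_of_ker {A C : Matrix ι ι ℂ} (hA : A.IsHermitian) (hC : C.IsHermitian)
    (h : ∀ v, C *ᵥ v = 0 → A *ᵥ v = 0) : im A ≤ im C := by
  classical
  rintro _ ⟨w, rfl⟩
  by_contra hw
  -- Separate `A w` from `im C` by a functional `f = ⟨u, ·⟩`. Vanishing on `im C` means `C u = 0`,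
  -- hence `A u = 0`, so `f` also kills `A w`.
  obtain ⟨f, hf, hCf⟩ := Submodule.exists_le_ker_of_notMem hw
  set u : ι → ℂ := fun i => star (f (Pi.single i 1)) with hu
  have hfu : ∀ v, f v = star u ⬝ᵥ v := by
    intro v
    conv_lhs => rw [pi_eq_sum_univ' v]
    simp [dotProduct, hu, mul_comm]
  have adj : ∀ {M : Matrix ι ι ℂ}, M.IsHermitian → ∀ v, f (M *ᵥ v) = star (M *ᵥ u) ⬝ᵥ v := by
    intro M hM v
    rw [hfu, star_mulVec, hM.eq, dotProduct_mulVec]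
  have hCu : C *ᵥ u = 0 := by
    rw [← dotProduct_star_self_eq_zero, ← adj hC]
    exact hCf ⟨_, rfl⟩
  exact hf (by rw [mulVecLin_apply, adj hA, h u hCu]; simp)

theorem im_le_im_add {A B : Matrix ι ι ℂ} (hA : A.PosSemidef) (hB : B.PosSemidef) :
    im A ≤ im (A + B) := by
  refine im_le_im_of_ker hA.isHermitian (hA.add hB).isHermitian fun v hv => ?_
  have h : star v ⬝ᵥ (A *ᵥ v) + star v ⬝ᵥ (B *ᵥ v) = 0 := by
    rw [← dotProduct_add, ← add_mulVec, hv, dotProduct_zero]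
  exact (hA.dotProduct_mulVec_zero_iff v).1
    ((add_eq_zero_iff_of_nonneg (hA.dotProduct_mulVec_nonneg v)
      (hB.dotProduct_mulVec_nonneg v)).1 h).1

theorem mem_im_vecMulVec_self_star (x : ι → ℂ) : x ∈ im (vecMulVec x (star x)) := by
  by_cases hx : x = 0
  · rw [hx]; exact Submodule.zero_mem _
  · have h : star x ⬝ᵥ x ≠ 0 := by
      rwa [Ne, dotProduct_star_self_eq_zero]
    refine ⟨(star x ⬝ᵥ x)⁻¹ • x, ?_⟩
    rw [mulVecLin_apply, vecMulVec_mulVec, dotProduct_smul]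
    simp [h]

theorem im_vecMulVec_le {U : Submodule ℂ (ι → ℂ)} {x : ι → ℂ} (hx : x ∈ U) (y : ι → ℂ) :
    im (vecMulVec x y) ≤ U := by
  rintro _ ⟨v, rfl⟩
  rw [mulVecLin_apply, vecMulVec_mulVec, op_smul_eq_smul]
  exact U.smul_mem (y ⬝ᵥ v) hx

open scoped MatrixOrder in
theorem exists_eq_conjTranspose_mul_self {A : Matrix ι ι ℂ} (hA : A.PosSemidef) :
    ∃ C : Matrix ι ι ℂ, A = Cᴴ * C := by
  classical
  exact CStarAlgebra.nonneg_iff_eq_star_mul_self.mp hA.nonneg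

/-- A rank one projector onto a vector in the image of `A` is dominated by a multiple of `A`. -/
theorem exists_posSemidef_smul_sub_vecMulVec {A : Matrix ι ι ℂ} (hA : A.PosSemidef) {x : ι → ℂ}
    (hx : x ∈ im A) : ∃ c : ℝ, 0 ≤ c ∧ (c • A - vecMulVec x (star x)).PosSemidef := by
  classical
  obtain ⟨u, rfl⟩ := hx
  obtain ⟨C, rfl⟩ := exists_eq_conjTranspose_mul_self hA
  -- With `A = Cᴴ C` and `x = Cᴴ w`, conjugation by `C` reduces the claim to `w w* ≤ ‖w‖² • 1`; so
  -- `c = ‖w‖²`.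
  set w := C *ᵥ u with hw
  set P := vecMulVec w (star w) with hP
  have hPH : Pᴴ = P := (posSemidef_vecMulVec_self_star w).isHermitian
  have hx : vecMulVec ((Cᴴ * C).mulVecLin u) (star ((Cᴴ * C).mulVecLin u)) = Cᴴ * P * C := by
    rw [mulVecLin_apply, ← mulVec_mulVec, ← hw, star_mulVec, conjTranspose_conjTranspose,
      hP, mul_vecMulVec, vecMulVec_mul]
  have hr0 : 0 ≤ star w ⬝ᵥ w := dotProduct_star_self_nonneg w
  obtain ⟨r, hr, hrw⟩ : ∃ r : ℝ, 0 ≤ r ∧ star w ⬝ᵥ w = r := by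
    refine ⟨(star w ⬝ᵥ w).re, (Complex.nonneg_iff.1 hr0).1, ?_⟩
    exact Complex.ext rfl (by simpa using (Complex.nonneg_iff.1 hr0).2.symm)
  have key : (r • (1 : Matrix ι ι ℂ) - P).PosSemidef := by
    rcases hr.eq_or_lt with h0 | hpos
    · have : w = 0 := by
        rw [← dotProduct_star_self_eq_zero, hrw, ← h0]; simp
      simp [hP, this, ← h0, PosSemidef.zero]
    · have hPP : P * P = r • P := by
        rw [hP, vecMulVec_mul_vecMulVec, hrw]
        ext i j
        simp [vecMulVec_apply, mul_left_comm]
      -- As `P * P = r • P`, the matrix `r • 1 - P` is Hermitian with square `r` times itself.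
      have hsq : r • (1 : Matrix ι ι ℂ) - P =
          r⁻¹ • ((r • (1 : Matrix ι ι ℂ) - P)ᴴ * (r • (1 : Matrix ι ι ℂ) - P)) := by
        rw [conjTranspose_sub, conjTranspose_smul, hPH, conjTranspose_one, sub_mul, mul_sub,
          mul_sub, hPP]
        simp [smul_smul, hpos.ne', smul_sub]
      rw [hsq]
      exact (posSemidef_conjTranspose_mul_self _).smul (inv_nonneg.2 hr)
  refine ⟨r, hr, ?_⟩
  rw [hx]
  have h := key.conjTranspose_mul_mul_same C
  rwa [mul_sub, sub_mul, Matrix.mul_smul, Matrix.smul_mul, mul_one] at h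

theorem exists_eq_sum_vecMulVec {A : Matrix ι ι ℂ} (hA : A.PosSemidef) :
    ∃ x : ι → ι → ℂ, A = ∑ k, vecMulVec (x k) (star (x k)) := by
  classical
  obtain ⟨C, rfl⟩ := exists_eq_conjTranspose_mul_self hA
  refine ⟨fun k => star (C k), ?_⟩
  ext i j
  simp [mul_apply, Matrix.sum_apply, vecMulVec_apply]

theorem trace_real_smul (c : ℝ) (M : Matrix ι ι ℂ) : (c • M).trace = c * M.trace := by
  rw [trace_smul]; simp

end Linear

/-! ### Product vectors and tensor products of subspaces. -/

section Tensor

variable {m n : ℕ}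

theorem row_mem_of_mem_tensorSubspace {V : Submodule ℂ (Fin m → ℂ)} {W : Submodule ℂ (Fin n → ℂ)}
    {z : Fin m × Fin n → ℂ} (hz : z ∈ tensorSubspace V W) (i : Fin m) :
    (fun j => z (i, j)) ∈ W := by
  induction hz using Submodule.span_induction with
  | mem z hz => obtain ⟨x, -, y, hy, rfl⟩ := hz; exact W.smul_mem (x i) hy
  | zero => exact W.zero_mem
  | add z w _ _ hz hw => exact W.add_mem hz hw
  | smul c z _ hz => exact W.smul_mem c hz

theorem col_mem_of_mem_tensorSubspace {V : Submodule ℂ (Fin m → ℂ)} {W : Submodule ℂ (Fin n → ℂ)}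
    {z : Fin m × Fin n → ℂ} (hz : z ∈ tensorSubspace V W) (j : Fin n) :
    (fun i => z (i, j)) ∈ V := by
  induction hz using Submodule.span_induction with
  | mem z hz =>
    obtain ⟨x, hx, y, -, rfl⟩ := hz
    simpa [prodVec, mul_comm, Pi.smul_def] using V.smul_mem (y j) hx
  | zero => exact V.zero_mem
  | add z w _ _ hz hw => exact V.add_mem hz hw
  | smul c z _ hz => exact V.smul_mem c hz

theorem prodVec_mem_tensorSubspace {V : Submodule ℂ (Fin m → ℂ)} {W : Submodule ℂ (Fin n → ℂ)}
    {x : Fin m → ℂ} {y : Fin n → ℂ} (hx : x ∈ V) (hy : y ∈ W) :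
    prodVec x y ∈ tensorSubspace V W :=
  Submodule.subset_span ⟨x, hx, y, hy, rfl⟩

theorem prodVec_mem_tensorSubspace_iff {V : Submodule ℂ (Fin m → ℂ)}
    {W : Submodule ℂ (Fin n → ℂ)} {x : Fin m → ℂ} {y : Fin n → ℂ} (hx : x ≠ 0) (hy : y ≠ 0) :
    prodVec x y ∈ tensorSubspace V W ↔ x ∈ V ∧ y ∈ W := by
  refine ⟨fun h => ?_, fun h => prodVec_mem_tensorSubspace h.1 h.2⟩
  obtain ⟨i, hi⟩ := Function.ne_iff.1 hx
  obtain ⟨j, hj⟩ := Function.ne_iff.1 hy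
  constructor
  · refine (V.smul_mem_iff hj).1 ?_
    simpa [prodVec, mul_comm, Pi.smul_def] using col_mem_of_mem_tensorSubspace h j
  · exact (W.smul_mem_iff hi).1 (row_mem_of_mem_tensorSubspace h i)

theorem iSupIndep_tensorSubspace {ι : Type*} {W : ι → Submodule ℂ (Fin n → ℂ)}
    (hW : iSupIndep W) (V : ι → Submodule ℂ (Fin m → ℂ)) :
    iSupIndep fun γ => tensorSubspace (V γ) (W γ) := by
  rw [iSupIndep_iff_finsetSum_eq_zero_imp_eq_zero] at hW ⊢
  intro s z hz hsum γ hγ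
  ext ⟨i, j⟩
  refine congrFun (hW s (fun γ j => z γ (i, j))
    (fun γ hγ => row_mem_of_mem_tensorSubspace (hz γ hγ) i) ?_ γ hγ) j
  ext j
  simpa using congrFun hsum (i, j)

/-- A row where `x` is nonzero splits `y` into parts `y' γ ∈ W γ`. Independence of the `W γ`,
applied to every row, gives `z γ = x ⊗ y' γ`, so `x ∈ V γ` whenever `y' γ ≠ 0`. Since `x ≠ 0` and
the `V γ` are pairwise disjoint, exactly one part survives. -/
theorem prodVec_mem_of_sum {ι : Type*} [Fintype ι] {V : ι → Submodule ℂ (Fin m → ℂ)}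
    {W : ι → Submodule ℂ (Fin n → ℂ)} (hV : Pairwise fun γ δ => Disjoint (V γ) (V δ))
    (hW : iSupIndep W) {x : Fin m → ℂ} {y : Fin n → ℂ} (hx : x ≠ 0) (hy : y ≠ 0)
    {z : ι → Fin m × Fin n → ℂ} (hz : ∀ γ, z γ ∈ tensorSubspace (V γ) (W γ))
    (hsum : prodVec x y = ∑ γ, z γ) : ∃ γ, x ∈ V γ ∧ y ∈ W γ := by
  obtain ⟨i₀, hi₀⟩ := Function.ne_iff.1 hx
  rw [Pi.zero_apply] at hi₀
  set y' : ι → Fin n → ℂ := fun γ => (x i₀)⁻¹ • fun j => z γ (i₀, j) with hy'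
  have hyW : ∀ γ, y' γ ∈ W γ := fun γ =>
    (W γ).smul_mem _ (row_mem_of_mem_tensorSubspace (hz γ) i₀)
  have hentry : ∀ i j, x i * y j = ∑ γ, z γ (i, j) := fun i j => by
    simpa [prodVec] using congrFun hsum (i, j)
  have hysum : y = ∑ γ, y' γ := by
    ext j
    simp [hy', ← Finset.mul_sum, ← hentry, hi₀]
  have hrow : ∀ γ i, (fun j => z γ (i, j)) = x i • y' γ := by
    intro γ i
    refine (iSupIndep_iff_finsetSum_eq_imp_eq W).1 hW Finset.univ (fun γ j => z γ (i, j))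
      (fun γ => x i • y' γ) (fun γ _ => ⟨row_mem_of_mem_tensorSubspace (hz γ) i,
        (W γ).smul_mem _ (hyW γ)⟩) ?_ γ (Finset.mem_univ γ)
    rw [← Finset.smul_sum, ← hysum]
    ext j
    simp [← hentry]
  have hxV : ∀ γ, y' γ ≠ 0 → x ∈ V γ := by
    intro γ hγ
    have : z γ = prodVec x (y' γ) := by
      ext ⟨i, j⟩
      exact congrFun (hrow γ i) j
    exact ((prodVec_mem_tensorSubspace_iff hx hγ).1 (this ▸ hz γ)).1
  obtain ⟨γ, hγ⟩ : ∃ γ, y' γ ≠ 0 := by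
    by_contra! h
    exact hy (by rw [hysum]; exact Finset.sum_eq_zero fun γ _ => h γ)
  refine ⟨γ, hxV γ hγ, ?_⟩
  have : y = y' γ := by
    rw [hysum]
    refine Finset.sum_eq_single γ (fun δ _ hδ => ?_) (by simp)
    by_contra h
    exact hx ((Submodule.disjoint_def.1 (hV hδ)) x (hxV δ h) (hxV γ hγ))
  rw [this]
  exact hyW γ

theorem im_kronecker_le (A : Matrix (Fin m) (Fin m) ℂ) (B : Matrix (Fin n) (Fin n) ℂ) :
    im (A ⊗ₖ B) ≤ tensorSubspace (im A) (im B) := by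
  rintro _ ⟨v, rfl⟩
  have h : (A ⊗ₖ B).mulVecLin v =
      ∑ k : Fin m × Fin n, v k • prodVec (A *ᵥ Pi.single k.1 1) (B *ᵥ Pi.single k.2 1) := by
    ext ⟨i, j⟩
    simp [mulVec, dotProduct, prodVec, kroneckerMap_apply, mul_comm]
  rw [h]
  exact Submodule.sum_mem _ fun k _ => Submodule.smul_mem _ _
    (prodVec_mem_tensorSubspace ⟨_, rfl⟩ ⟨_, rfl⟩)

theorem vecMulVec_kronecker_vecMulVec (x : Fin m → ℂ) (y : Fin n → ℂ) :
    vecMulVec x (star x) ⊗ₖ vecMulVec y (star y) =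
      vecMulVec (prodVec x y) (star (prodVec x y)) := by
  ext ⟨i, j⟩ ⟨k, l⟩
  simp [vecMulVec_apply, kroneckerMap_apply, prodVec]
  ring

end Tensor

/-! ### The separable cone and its faces. -/

section Cone

variable {m n : ℕ}

/-- The convex cone of unnormalised separable states, generated by the projectors onto product
vectors. -/
def sepCone (m n : ℕ) : AddSubmonoid (BiMat m n) :=
  AddSubmonoid.closure {M | ∃ x y, M = vecMulVec (prodVec x y) (star (prodVec x y))}

theorem vecMulVec_prodVec_mem_sepCone (x : Fin m → ℂ) (y : Fin n → ℂ) :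
    vecMulVec (prodVec x y) (star (prodVec x y)) ∈ sepCone m n :=
  AddSubmonoid.subset_closure ⟨x, y, rfl⟩

theorem posSemidef_of_mem_sepCone {X : BiMat m n} (hX : X ∈ sepCone m n) : X.PosSemidef := by
  induction hX using AddSubmonoid.closure_induction with
  | mem X hX => obtain ⟨x, y, rfl⟩ := hX; exact posSemidef_vecMulVec_self_star _
  | zero => exact PosSemidef.zero
  | add X Y _ _ hX hY => exact hX.add hY

theorem smul_mem_sepCone {c : ℝ} (hc : 0 ≤ c) {X : BiMat m n} (hX : X ∈ sepCone m n) :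
    c • X ∈ sepCone m n := by
  induction hX using AddSubmonoid.closure_induction with
  | mem X hX =>
    obtain ⟨x, y, rfl⟩ := hX
    -- Generators are unnormalised, so a nonnegative scalar is absorbed as `√c` into `x`.
    convert vecMulVec_prodVec_mem_sepCone (((Real.sqrt c : ℝ) : ℂ) • x) y using 1
    have h : ((Real.sqrt c : ℝ) : ℂ) * ((Real.sqrt c : ℝ) : ℂ) = c := by
      rw [← Complex.ofReal_mul, Real.mul_self_sqrt hc]
    ext i j
    simp only [Matrix.smul_apply, vecMulVec_apply, prodVec, Pi.star_apply, Pi.smul_apply,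
      smul_eq_mul, star_mul', Complex.star_def, Complex.conj_ofReal, Complex.real_smul, ← h]
    ring
  | zero => simp
  | add X Y _ _ hX hY => rw [smul_add]; exact add_mem hX hY

theorem kronecker_mem_sepCone {A : Matrix (Fin m) (Fin m) ℂ} {B : Matrix (Fin n) (Fin n) ℂ}
    (hA : A.PosSemidef) (hB : B.PosSemidef) : A ⊗ₖ B ∈ sepCone m n := by
  obtain ⟨x, rfl⟩ := exists_eq_sum_vecMulVec hA
  obtain ⟨y, rfl⟩ := exists_eq_sum_vecMulVec hB
  have h : (∑ k, vecMulVec (x k) (star (x k))) ⊗ₖ (∑ k, vecMulVec (y k) (star (y k))) =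
      ∑ k, ∑ l, vecMulVec (prodVec (x k) (y l)) (star (prodVec (x k) (y l))) := by
    simp_rw [← vecMulVec_kronecker_vecMulVec]
    ext ⟨i, j⟩ ⟨i', j'⟩
    simp only [kroneckerMap_apply, Matrix.sum_apply, Finset.sum_mul_sum]
  rw [h]
  exact sum_mem fun k _ => sum_mem fun l _ => vecMulVec_prodVec_mem_sepCone _ _

theorem exists_sum_kronecker_of_mem_sepCone {X : BiMat m n} (hX : X ∈ sepCone m n) :
    ∃ (k : ℕ) (A : Fin k → Matrix (Fin m) (Fin m) ℂ) (B : Fin k → Matrix (Fin n) (Fin n) ℂ),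
      (∀ i, (A i).PosSemidef) ∧ (∀ i, (B i).PosSemidef) ∧ X = ∑ i, A i ⊗ₖ B i := by
  induction hX using AddSubmonoid.closure_induction_left with
  | zero => exact ⟨0, fun _ => 0, fun _ => 0, fun i => i.elim0, fun i => i.elim0, by simp⟩
  | add_left X hX Y _ hY =>
    obtain ⟨x, y, rfl⟩ := hX
    obtain ⟨k, A, B, hA, hB, rfl⟩ := hY
    refine ⟨k + 1, Fin.cons (vecMulVec x (star x)) A, Fin.cons (vecMulVec y (star y)) B,
      fun i => ?_, fun i => ?_, ?_⟩
    · refine Fin.cases ?_ (fun i => ?_) i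
      · exact posSemidef_vecMulVec_self_star x
      · exact hA i
    · refine Fin.cases ?_ (fun i => ?_) i
      · exact posSemidef_vecMulVec_self_star y
      · exact hB i
    · rw [Fin.sum_univ_succ]
      simp only [Fin.cons_zero, Fin.cons_succ, vecMulVec_kronecker_vecMulVec]

theorem mem_separableStates_iff {X : BiMat m n} :
    X ∈ separableStates m n ↔ X ∈ sepCone m n ∧ X.trace = 1 := by
  constructor
  · rintro ⟨hX, k, A, B, hA, hB, rfl⟩
    exact ⟨sum_mem fun i _ => kronecker_mem_sepCone (hA i) (hB i), hX.2⟩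
  · rintro ⟨hX, htr⟩
    exact ⟨⟨posSemidef_of_mem_sepCone hX, htr⟩, exists_sum_kronecker_of_mem_sepCone hX⟩

theorem exists_trace_eq_ofReal {X : BiMat m n} (hX : X ∈ sepCone m n) :
    ∃ r : ℝ, 0 ≤ r ∧ X.trace = r := by
  have h := Complex.nonneg_iff.1 (posSemidef_of_mem_sepCone hX).trace_nonneg
  exact ⟨X.trace.re, h.1, Complex.ext rfl (by simpa using h.2.symm)⟩

theorem convex_separableStates : Convex ℝ (separableStates m n) := by
  intro X hX Y hY a b ha hb hab
  rw [mem_separableStates_iff] at *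
  refine ⟨add_mem (smul_mem_sepCone ha hX.1) (smul_mem_sepCone hb hY.1), ?_⟩
  rw [trace_add, trace_real_smul, trace_real_smul, hX.2, hY.2, mul_one, mul_one]
  exact_mod_cast hab

/-- The separable states dominated by a multiple of `X` in the order of the separable cone. -/
def dominatedStates (X : BiMat m n) : Set (BiMat m n) :=
  {Y | Y ∈ separableStates m n ∧ ∃ c : ℝ, 0 ≤ c ∧ c • X - Y ∈ sepCone m n}

theorem convex_dominatedStates (X : BiMat m n) : Convex ℝ (dominatedStates X) := by
  rintro Y ⟨hY, c, hc, hcY⟩ Z ⟨hZ, d, hd, hdZ⟩ a b ha hb hab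
  refine ⟨convex_separableStates hY hZ ha hb hab, a * c + b * d, by positivity, ?_⟩
  have h := add_mem (smul_mem_sepCone ha hcY) (smul_mem_sepCone hb hdZ)
  convert h using 1
  module

theorem isExtreme_dominatedStates (X : BiMat m n) :
    IsExtreme ℝ (separableStates m n) (dominatedStates X) := by
  refine ⟨fun Y hY => hY.1, ?_⟩
  rintro Y hY Z hZ _ ⟨-, c, hc, hW⟩ ⟨a, b, ha, hb, hab, rfl⟩
  refine ⟨hY, a⁻¹ * c, by positivity, ?_⟩
  have h := smul_mem_sepCone (inv_nonneg.2 ha.le)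
    (add_mem hW (smul_mem_sepCone hb.le (mem_separableStates_iff.1 hZ).1))
  convert h using 1
  rw [show c • X - (a • Y + b • Z) + b • Z = c • X - a • Y by module, smul_sub, smul_smul,
    smul_smul, inv_mul_cancel₀ ha.ne', one_smul]

theorem generatedFace_separableStates {X : BiMat m n} (hX : X ∈ separableStates m n) :
    generatedFace (separableStates m n) X = dominatedStates X := by
  refine subset_antisymm (fun Y hY => hY.2 _ (isExtreme_dominatedStates X)
    ⟨hX, 1, zero_le_one, by simp⟩) ?_
  rintro Y ⟨hY, c, hc, hcY⟩
  refine ⟨hX, fun F hF hXF => ?_⟩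
  have hX' := mem_separableStates_iff.1 hX
  have hY' := mem_separableStates_iff.1 hY
  have hc1 : 1 ≤ c := by
    have h := (posSemidef_of_mem_sepCone hcY).trace_nonneg
    rw [trace_sub, trace_real_smul, hX'.2, hY'.2, mul_one, sub_nonneg] at h
    exact_mod_cast h
  have hc0 : 0 < c := by linarith
  -- `X` is to lie strictly between `Y` and a second state. The extra `X` gives the remainder trace
  -- `c > 0`, even when `c • X - Y = 0`.
  have hZ : c⁻¹ • (c • X - Y + X) ∈ separableStates m n := by
    refine mem_separableStates_iff.2
      ⟨smul_mem_sepCone (inv_nonneg.2 hc) (add_mem hcY hX'.1), ?_⟩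
    rw [trace_real_smul, trace_add, trace_sub, trace_real_smul, hX'.2, hY'.2]
    have : (c : ℂ) ≠ 0 := by exact_mod_cast hc0.ne'
    push_cast
    field_simp
    ring
  refine hF.left_mem_of_mem_openSegment hY hZ hXF
    ⟨(c + 1)⁻¹, c * (c + 1)⁻¹, by positivity, by positivity, by field_simp; ring, ?_⟩
  rw [smul_smul, show c * (c + 1)⁻¹ * c⁻¹ = (c + 1)⁻¹ by field_simp, ← smul_add,
    show Y + (c • X - Y + X) = (c + 1) • X by module, smul_smul,
    inv_mul_cancel₀ (by positivity), one_smul]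

theorem dominatedStates_smul {c : ℝ} (hc : 0 < c) (X : BiMat m n) :
    dominatedStates (c • X) = dominatedStates X := by
  ext Y
  refine and_congr_right fun _ => ⟨?_, ?_⟩
  · rintro ⟨d, hd, h⟩
    exact ⟨d * c, by positivity, by rwa [mul_smul]⟩
  · rintro ⟨d, hd, h⟩
    exact ⟨d * c⁻¹, by positivity, by rwa [smul_smul, inv_mul_cancel_right₀ hc.ne']⟩

theorem dominatedStates_zero : dominatedStates (0 : BiMat m n) = ∅ := by
  rw [Set.eq_empty_iff_forall_notMem]
  rintro Y ⟨hY, c, -, hc⟩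
  have h := (posSemidef_of_mem_sepCone hc).trace_nonneg
  rw [smul_zero, zero_sub, trace_neg, (mem_separableStates_iff.1 hY).2] at h
  norm_num at h

theorem sepFace_eq_dominatedStates {X : BiMat m n} (hX : X ∈ sepCone m n) :
    sepFace X = dominatedStates X := by
  obtain ⟨r, hr, htr⟩ := exists_trace_eq_ofReal hX
  rcases hr.eq_or_lt with rfl | hpos
  · have h0 : X = 0 := (posSemidef_of_mem_sepCone hX).trace_eq_zero_iff.1 (by simpa using htr)
    subst h0
    rw [dominatedStates_zero, sepFace, Set.eq_empty_iff_forall_notMem]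
    rintro Y ⟨h, -⟩
    simpa using (mem_separableStates_iff.1 h).2
  · have hsm : X.trace⁻¹ • X = r⁻¹ • X := by ext; simp [htr]
    have hr0 : (r : ℂ) ≠ 0 := by exact_mod_cast hpos.ne'
    rw [sepFace, hsm, generatedFace_separableStates, dominatedStates_smul (inv_pos.2 hpos)]
    refine mem_separableStates_iff.2 ⟨smul_mem_sepCone (inv_nonneg.2 hr) hX, ?_⟩
    rw [trace_real_smul, htr]
    simp [hr0]

theorem im_le_of_dominated {X Y : BiMat m n} (hY : Y ∈ sepCone m n) {c : ℝ}
    (h : c • X - Y ∈ sepCone m n) : im Y ≤ im X := by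
  have h1 := im_le_im_add (posSemidef_of_mem_sepCone hY) (posSemidef_of_mem_sepCone h)
  rw [add_sub_cancel] at h1
  exact h1.trans (im_real_smul_le c X)

theorem exists_smul_sub_mem_sepCone {A : Matrix (Fin m) (Fin m) ℂ}
    {B : Matrix (Fin n) (Fin n) ℂ} (hA : A.PosSemidef) (hB : B.PosSemidef) {Y : BiMat m n}
    (hY : Y ∈ sepCone m n) (him : im Y ≤ tensorSubspace (im A) (im B)) :
    ∃ c : ℝ, 0 ≤ c ∧ c • (A ⊗ₖ B) - Y ∈ sepCone m n := by
  induction hY using AddSubmonoid.closure_induction with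
  | mem Y hY =>
    obtain ⟨x, y, rfl⟩ := hY
    by_cases h0 : x = 0 ∨ y = 0
    · refine ⟨0, le_rfl, ?_⟩
      have : prodVec x y = 0 := by
        ext i
        rcases h0 with h0 | h0 <;> simp [prodVec, h0]
      simp [this]
    push Not at h0
    obtain ⟨hx, hy⟩ := (prodVec_mem_tensorSubspace_iff h0.1 h0.2).1
      (him (mem_im_vecMulVec_self_star _))
    obtain ⟨a, ha, hxa⟩ := exists_posSemidef_smul_sub_vecMulVec hA hx
    obtain ⟨b, hb, hyb⟩ := exists_posSemidef_smul_sub_vecMulVec hB hy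
    refine ⟨a * b, by positivity, ?_⟩
    -- Telescoping, with `P = x x*` and `Q = y y*`: `aA ⊗ bB - P ⊗ Q = (aA - P) ⊗ bB + P ⊗ (bB -
    -- Q)`.
    have h := add_mem (kronecker_mem_sepCone hxa (hB.smul hb))
      (kronecker_mem_sepCone (posSemidef_vecMulVec_self_star x) hyb)
    convert h using 1
    rw [← vecMulVec_kronecker_vecMulVec]
    ext i j
    simp only [Matrix.sub_apply, Matrix.smul_apply, Matrix.add_apply, kroneckerMap_apply,
      Complex.real_smul]
    push_cast
    ring
  | zero => exact ⟨0, le_rfl, by simp⟩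
  | add X Y hX hY ihX ihY =>
    have hX' := posSemidef_of_mem_sepCone hX
    have hY' := posSemidef_of_mem_sepCone hY
    obtain ⟨c, hc, hcX⟩ := ihX ((im_le_im_add hX' hY').trans him)
    obtain ⟨d, hd, hdY⟩ := ihY ((im_le_im_add hY' hX').trans (add_comm X Y ▸ him))
    refine ⟨c + d, by positivity, ?_⟩
    convert add_mem hcX hdY using 1
    module

theorem sepFace_kronecker {A : Matrix (Fin m) (Fin m) ℂ} {B : Matrix (Fin n) (Fin n) ℂ}
    (hA : A.PosSemidef) (hB : B.PosSemidef) : sepFace (A ⊗ₖ B) = Sep (im A) (im B) := by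
  rw [sepFace_eq_dominatedStates (kronecker_mem_sepCone hA hB)]
  ext Y
  refine and_congr_right fun hY => ⟨?_, exists_smul_sub_mem_sepCone hA hB
    (mem_separableStates_iff.1 hY).1⟩
  rintro ⟨c, -, h⟩
  exact (im_le_of_dominated (mem_separableStates_iff.1 hY).1 h).trans (im_kronecker_le A B)

theorem convex_Sep (V : Submodule ℂ (Fin m → ℂ)) (W : Submodule ℂ (Fin n → ℂ)) :
    Convex ℝ (Sep V W) := fun _ hX _ hY a b ha hb hab =>
  ⟨convex_separableStates hX.1 hY.1 ha hb hab, im_add_le ((im_real_smul_le a _).trans hX.2)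
    ((im_real_smul_le b _).trans hY.2)⟩

end Cone

/-! ### Block decomposition and its uniqueness. -/

section DirectSum

variable {m n : ℕ} {ι : Type*} [Fintype ι]

theorem exists_sum_of_mem_sepCone [DecidableEq ι] {V : ι → Submodule ℂ (Fin m → ℂ)}
    {W : ι → Submodule ℂ (Fin n → ℂ)} (hV : Pairwise fun γ δ => Disjoint (V γ) (V δ))
    (hW : iSupIndep W) {X Y : BiMat m n}
    (hX : ∀ v, ∃ z : ι → Fin m × Fin n → ℂ,
      (∀ γ, z γ ∈ tensorSubspace (V γ) (W γ)) ∧ X *ᵥ v = ∑ γ, z γ)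
    (hY : Y ∈ sepCone m n) (him : im Y ≤ im X) :
    ∃ Z : ι → BiMat m n, (∀ γ, Z γ ∈ sepCone m n) ∧
      (∀ γ, im (Z γ) ≤ tensorSubspace (V γ) (W γ)) ∧ Y = ∑ γ, Z γ := by
  induction hY using AddSubmonoid.closure_induction with
  | mem Y hY =>
    obtain ⟨x, y, rfl⟩ := hY
    by_cases h0 : x = 0 ∨ y = 0
    · have : prodVec x y = 0 := by
        ext i
        rcases h0 with h0 | h0 <;> simp [prodVec, h0]
      exact ⟨fun _ => 0, fun _ => zero_mem _, fun _ => by simp [im_zero], by simp [this]⟩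
    push Not at h0
    obtain ⟨v, hv⟩ := him (mem_im_vecMulVec_self_star (prodVec x y))
    obtain ⟨z, hz, hsum⟩ := hX v
    obtain ⟨γ, hxγ, hyγ⟩ := prodVec_mem_of_sum hV hW h0.1 h0.2 hz (hv.symm.trans hsum)
    refine ⟨Pi.single γ (vecMulVec (prodVec x y) (star (prodVec x y))), fun δ => ?_,
      fun δ => ?_, by simp⟩
    · rcases eq_or_ne δ γ with rfl | h
      · simpa using vecMulVec_prodVec_mem_sepCone x y
      · simp [h]
    · rcases eq_or_ne δ γ with rfl | h
      · rw [Pi.single_eq_same]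
        exact im_vecMulVec_le (prodVec_mem_tensorSubspace hxγ hyγ) _
      · simp [h, im_zero]
  | zero => exact ⟨fun _ => 0, fun _ => zero_mem _, fun _ => by simp [im_zero], by simp⟩
  | add Y₁ Y₂ h₁ h₂ ih₁ ih₂ =>
    have h₁' := posSemidef_of_mem_sepCone h₁
    have h₂' := posSemidef_of_mem_sepCone h₂
    obtain ⟨Z₁, hZ₁, hi₁, rfl⟩ := ih₁ ((im_le_im_add h₁' h₂').trans him)
    obtain ⟨Z₂, hZ₂, hi₂, rfl⟩ := ih₂ ((im_le_im_add h₂' h₁').trans (add_comm Y₂ _ ▸ him))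
    exact ⟨fun γ => Z₁ γ + Z₂ γ, fun γ => add_mem (hZ₁ γ) (hZ₂ γ),
      fun γ => im_add_le (hi₁ γ) (hi₂ γ), Finset.sum_add_distrib.symm⟩

/-- The weights are the traces of the blocks; a positive semidefinite block of trace zero vanishes.
-/
theorem exists_isConvexDecomp {V : ι → Submodule ℂ (Fin m → ℂ)}
    {W : ι → Submodule ℂ (Fin n → ℂ)} {Z : ι → BiMat m n} (hZ : ∀ γ, Z γ ∈ sepCone m n)
    (him : ∀ γ, im (Z γ) ≤ tensorSubspace (V γ) (W γ)) (htr : (∑ γ, Z γ).trace = 1) :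
    ∃ w y, IsConvexDecomp (fun γ => Sep (V γ) (W γ)) (∑ γ, Z γ) w y := by
  choose w hw hwtr using fun γ => exists_trace_eq_ofReal (hZ γ)
  refine ⟨w, fun γ => (w γ)⁻¹ • Z γ, hw, ?_, fun γ hγ => ⟨mem_separableStates_iff.2
    ⟨smul_mem_sepCone (inv_nonneg.2 (hw γ)) (hZ γ), ?_⟩, (im_real_smul_le _ _).trans (him γ)⟩, ?_⟩
  · rw [trace_sum] at htr
    simp_rw [hwtr] at htr
    exact_mod_cast htr
  · have : (w γ : ℂ) ≠ 0 := by exact_mod_cast hγ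
    rw [trace_real_smul, hwtr]
    simp [this]
  · refine Finset.sum_congr rfl fun γ _ => ?_
    by_cases h : w γ = 0
    · rw [h, zero_smul]
      exact (posSemidef_of_mem_sepCone (hZ γ)).trace_eq_zero_iff.1 (by simp [hwtr, h])
    · rw [smul_smul, mul_inv_cancel₀ h, one_smul]

/-- Independence is applied column by column. -/
theorem eq_of_sum_eq_of_iSupIndep {κ : Type*} [Fintype κ] {U : ι → Submodule ℂ (κ → ℂ)}
    (hU : iSupIndep U) {M N : ι → Matrix κ κ ℂ} (hM : ∀ γ, im (M γ) ≤ U γ)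
    (hN : ∀ γ, im (N γ) ≤ U γ) (h : ∑ γ, M γ = ∑ γ, N γ) : M = N := by
  classical
  funext γ
  refine Matrix.ext_of_mulVec_single fun i => ?_
  refine (iSupIndep_iff_finsetSum_eq_imp_eq U).1 hU Finset.univ
    (fun γ => M γ *ᵥ Pi.single i 1) (fun γ => N γ *ᵥ Pi.single i 1)
    (fun γ _ => ⟨hM γ ⟨_, rfl⟩, hN γ ⟨_, rfl⟩⟩) ?_ γ (Finset.mem_univ γ)
  rw [← sum_mulVec, ← sum_mulVec, h]

theorem IsConvexDecomp.unique {V : ι → Submodule ℂ (Fin m → ℂ)}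
    {W : ι → Submodule ℂ (Fin n → ℂ)} (hW : iSupIndep W) {X : BiMat m n} {w w' : ι → ℝ}
    {y y' : ι → BiMat m n} (h : IsConvexDecomp (fun γ => Sep (V γ) (W γ)) X w y)
    (h' : IsConvexDecomp (fun γ => Sep (V γ) (W γ)) X w' y') :
    w = w' ∧ ∀ γ, w γ ≠ 0 → y γ = y' γ := by
  have him : ∀ {w : ι → ℝ} {y : ι → BiMat m n},
      IsConvexDecomp (fun γ => Sep (V γ) (W γ)) X w y →
      ∀ γ, im (w γ • y γ) ≤ tensorSubspace (V γ) (W γ) := by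
    intro w y h γ
    by_cases hγ : w γ = 0
    · simp [hγ, im_zero]
    · exact (im_real_smul_le _ _).trans (h.2.2.1 γ hγ).2
  have htr : ∀ {w : ι → ℝ} {y : ι → BiMat m n},
      IsConvexDecomp (fun γ => Sep (V γ) (W γ)) X w y → ∀ γ, (w γ • y γ).trace = w γ := by
    intro w y h γ
    by_cases hγ : w γ = 0
    · simp [hγ]
    · rw [trace_real_smul, (mem_separableStates_iff.1 (h.2.2.1 γ hγ).1).2, mul_one]
  have heq : (fun γ => w γ • y γ) = fun γ => w' γ • y' γ :=
    eq_of_sum_eq_of_iSupIndep (iSupIndep_tensorSubspace hW V) (him h) (him h')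
      (h.2.2.2.symm.trans h'.2.2.2)
  -- States have trace one, so the weight is the trace of the already determined block.
  have hw : w = w' := by
    funext γ
    have := (htr h γ).symm.trans ((congrArg trace (congrFun heq γ)).trans (htr h' γ))
    exact_mod_cast this
  subst hw
  exact ⟨rfl, fun γ hγ => smul_right_injective _ hγ (congrFun heq γ)⟩

theorem IsConvexDecomp.mem_convexHull {E : Type*} [AddCommGroup E] [Module ℝ E] {C : ι → Set E}
    {x : E} {w : ι → ℝ} {y : ι → E} (h : IsConvexDecomp C x w y) :
    x ∈ convexHull ℝ (⋃ γ, C γ) := by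
  rw [h.2.2.2, ← finsum_eq_sum_of_fintype]
  refine (convex_convexHull ℝ _).finsum_mem h.1 ?_ fun γ hγ =>
    subset_convexHull ℝ _ (Set.mem_iUnion.2 ⟨γ, h.2.2.1 γ hγ⟩)
  rw [finsum_eq_sum_of_fintype, h.2.1]

theorem isDirectConvexSum_sepFace {A : ι → Matrix (Fin m) (Fin m) ℂ}
    {B : ι → Matrix (Fin n) (Fin n) ℂ} (hA : ∀ γ, (A γ).PosSemidef)
    (hB : ∀ γ, (B γ).PosSemidef) (htr : (∑ γ, A γ ⊗ₖ B γ).trace = 1)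
    (hAdisj : Pairwise fun γ δ => Disjoint (im (A γ)) (im (A δ)))
    (hBindep : iSupIndep fun γ => im (B γ)) :
    IsDirectConvexSum (generatedFace (separableStates m n) (∑ γ, A γ ⊗ₖ B γ))
      (fun γ => Sep (im (A γ)) (im (B γ))) := by
  classical
  have hK : ∀ γ, A γ ⊗ₖ B γ ∈ sepCone m n := fun γ => kronecker_mem_sepCone (hA γ) (hB γ)
  rw [generatedFace_separableStates
    (mem_separableStates_iff.2 ⟨sum_mem fun γ _ => hK γ, htr⟩)]
  have hdecomp : ∀ Y ∈ dominatedStates (∑ γ, A γ ⊗ₖ B γ), ∃ w y,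
      IsConvexDecomp (fun γ => Sep (im (A γ)) (im (B γ))) Y w y := by
    rintro Y ⟨hY, c, -, hc⟩
    rw [mem_separableStates_iff] at hY
    obtain ⟨Z, hZ, him, rfl⟩ := exists_sum_of_mem_sepCone hAdisj hBindep
      (fun v => ⟨fun γ => (A γ ⊗ₖ B γ) *ᵥ v, fun γ => im_kronecker_le _ _ ⟨v, rfl⟩,
        sum_mulVec _ _ _⟩) hY.1 (im_le_of_dominated hY.1 hc)
    exact exists_isConvexDecomp hZ him hY.2
  refine ⟨fun γ => convex_Sep _ _, subset_antisymm ?_ ?_, fun Y hY =>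
    ⟨hdecomp Y hY, fun w y w' y' h h' => h.unique hBindep h'⟩⟩
  · intro Y hY
    obtain ⟨w, y, h⟩ := hdecomp Y hY
    exact h.mem_convexHull
  · refine convexHull_min (Set.iUnion_subset fun γ Y hY => ?_) (convex_dominatedStates _)
    obtain ⟨c, hc, h⟩ := exists_smul_sub_mem_sepCone (hA γ) (hB γ)
      (mem_separableStates_iff.1 hY.1).1 hY.2
    refine ⟨hY.1, c, hc, ?_⟩
    -- The other blocks lie in the cone, so a state dominated by one block is dominated by the whole
    -- sum with the same `c`.
    have hrest := smul_mem_sepCone hc (sum_mem fun δ (_ : δ ∈ Finset.univ.erase γ) => hK δ)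
    convert add_mem h hrest using 1
    rw [← Finset.add_sum_erase _ _ (Finset.mem_univ γ), smul_add]
    abel

end DirectSum

end SepFaces

theorem mainTheorem3 (m n p : ℕ)
    (A : Fin p → Matrix (Fin m) (Fin m) ℂ) (B : Fin p → Matrix (Fin n) (Fin n) ℂ)
    (T : SepFaces.BiMat m n)
    (hT : T = ∑ γ, A γ ⊗ₖ B γ)
    (hTdens : SepFaces.IsDensity T)
    (hA : ∀ γ, SepFaces.IsDensity (A γ))
    (hAdisj : Pairwise fun γ δ => Disjoint (SepFaces.im (A γ)) (SepFaces.im (A δ)))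
    (hB : ∀ γ, (B γ).PosSemidef)
    (hBindep : iSupIndep fun γ => SepFaces.im (B γ)) :
    SepFaces.IsDirectConvexSum
        (SepFaces.generatedFace (SepFaces.separableStates m n) T)
        (fun γ => SepFaces.sepFace (A γ ⊗ₖ B γ)) ∧
      ∀ γ, SepFaces.sepFace (A γ ⊗ₖ B γ) =
        SepFaces.Sep (SepFaces.im (A γ)) (SepFaces.im (B γ)) := by
  have hface := fun γ => SepFaces.sepFace_kronecker (hA γ).1 (hB γ)
  subst hT
  refine ⟨?_, hface⟩
  simp_rw [hface]
  exact SepFaces.isDirectConvexSum_sepFace (fun γ => (hA γ).1) hB hTdens.2 hAdisj hBindep
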